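/- Let $k$ be a field and $\lambda\in k$ (in particular $k=\mathbb{C}$ with any $\lambda\in\mathbb{C}$, or $k=\mathbb{C}(\lambda)$ with $\lambda$ the variable). Let $Q$ be the quiver with two vertices $R$ and $M$, two loops $a,b$ at $M$, one arrow $c$ from $M$ to $R$ and one arrow $d$ from $R$ to $M$. Compose paths from right to left, and let $A$ be the path algebra $kQ$ modulo the two-sided ideal generated by $$(b^2+dc)d,\qquad c(b^2+dc),\qquad ab+ba,\qquad a^2+bdc+dcb+\lambda b^2+b^3 .$$ For a vertex $i$ let $e_i\in A$ be the trivial path at $i$ and let $P_i=e_iA$ be the right $A$-module spanned by the paths ending at $i$. Let $L_R$ be the vertex simple at $R$, that is, the one-dimensional right $A$-module on which $e_R$ acts as the identity and $e_M,a,b,c,d$ act as zero, and let $P_R\to L_R$ be the canonical map sending $e_R$ to $1$. Then $P_R$ and $P_M$ are projective right $A$-modules, and the sequence of right $A$-modules $$0\longrightarrow P_R\xrightarrow{\;d\;}P_M\xrightarrow{\;b^2+dc\;}P_M\xrightarrow{\;c\;}P_R\longrightarrow L_R\longrightarrow 0,$$ whose three maps between projectives are left multiplications by the indicated elements, is exact.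 Thus it is a projective resolution of $L_R$. -/

import Mathlib

universe u v w

/-- Generators of the path algebra of a quiver: the trivial paths (one for each vertex) and the
arrows. -/
inductive PathGen (V : Type v) [Quiver.{w} V] : Type (max v w)
  | vertex (i : V) : PathGen V
  | arrow {i j : V} (f : i ⟶ j) : PathGen V

/-- The defining relations of the path algebra of a quiver with finitely many vertices. Paths are
composed from right to left: for an arrow `f : i ⟶ j` one has `e_j f = f = f e_i`. -/
inductive PathRel (K : Type u) [Field K] (V : Type v) [Quiver.{w} V] [Fintype V] :
    FreeAlgebra K (PathGen V) → FreeAlgebra K (PathGen V) → Prop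
  | idem (i : V) :
      PathRel K V (FreeAlgebra.ι K (PathGen.vertex i) * FreeAlgebra.ι K (PathGen.vertex i))
        (FreeAlgebra.ι K (PathGen.vertex i))
  | orth (i j : V) (h : i ≠ j) :
      PathRel K V (FreeAlgebra.ι K (PathGen.vertex i) * FreeAlgebra.ι K (PathGen.vertex j)) 0
  | one : PathRel K V (∑ i : V, FreeAlgebra.ι K (PathGen.vertex i)) 1
  | target {i j : V} (f : i ⟶ j) :
      PathRel K V (FreeAlgebra.ι K (PathGen.vertex j) * FreeAlgebra.ι K (PathGen.arrow f))
        (FreeAlgebra.ι K (PathGen.arrow f))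
  | source {i j : V} (f : i ⟶ j) :
      PathRel K V (FreeAlgebra.ι K (PathGen.arrow f) * FreeAlgebra.ι K (PathGen.vertex i))
        (FreeAlgebra.ι K (PathGen.arrow f))

/-- The path algebra over `K` of a quiver with finitely many vertices. -/
abbrev PathAlg (K : Type u) [Field K] (V : Type v) [Quiver.{w} V] [Fintype V] :=
  RingQuot (PathRel K V)

namespace PathAlg

variable (K : Type u) [Field K] {V : Type v} [Quiver.{w} V] [Fintype V]

/-- The trivial path at a vertex. -/
noncomputable def idem (i : V) : PathAlg K V :=
  RingQuot.mkAlgHom K (PathRel K V) (FreeAlgebra.ι K (PathGen.vertex i))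

/-- An arrow as an element of the path algebra. -/
noncomputable def arrow {i j : V} (f : i ⟶ j) : PathAlg K V :=
  RingQuot.mkAlgHom K (PathRel K V) (FreeAlgebra.ι K (PathGen.arrow f))

open Classical in
/-- The value of the one-dimensional representation at the vertex `i` on a generator: the trivial
path at `i` acts as `1`, the other trivial paths and all arrows act as `0`. -/
noncomputable def genChar (i : V) : PathGen V → K
  | PathGen.vertex j => if j = i then 1 else 0
  | PathGen.arrow _ => 0

/-- The one-dimensional representation of the path algebra at the vertex `i`. -/
noncomputable def vertexChar (i : V) : PathAlg K V →ₐ[K] K :=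
  RingQuot.liftAlgHom K ⟨FreeAlgebra.lift K (genChar K i), by
    intro x y h
    induction h with
    | idem j => by_cases hj : j = i <;> simp [genChar, hj]
    | orth j k hjk =>
      by_cases hj : j = i
      · have hk : k ≠ i := fun hk => hjk (hj.trans hk.symm)
        simp [genChar, hj, hk]
      · simp [genChar, hj]
    | one =>
      simp only [map_sum, FreeAlgebra.lift_ι_apply, map_one, genChar]
      rw [Finset.sum_eq_single i (fun j _ hj => if_neg hj) (fun h => absurd (Finset.mem_univ i) h),
        if_pos rfl]
    | target f => simp [genChar]
    | source f => simp [genChar]⟩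

@[simp]
theorem vertexChar_arrow (i : V) {j k : V} (f : j ⟶ k) : vertexChar K i (arrow K f) = 0 := by
  simp [vertexChar, arrow, genChar]

@[simp]
theorem vertexChar_idem_self (i : V) : vertexChar K i (idem K i) = 1 := by
  simp [vertexChar, idem, genChar]

end PathAlg

namespace MorrisonPinkham

/-- The two vertices of the Morrison–Pinkham quiver. -/
inductive Vertex : Type
  | R
  | M
  deriving DecidableEq

instance : Fintype Vertex := ⟨{Vertex.R, Vertex.M}, by rintro (_ | _) <;> decide⟩

/-- The arrows: loops `a`, `b` at `M`, an arrow `c` from `M` to `R` and an arrow `d` from `R` to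
`M`. -/
inductive Arrow : Vertex → Vertex → Type
  | a : Arrow Vertex.M Vertex.M
  | b : Arrow Vertex.M Vertex.M
  | c : Arrow Vertex.M Vertex.R
  | d : Arrow Vertex.R Vertex.M

instance : Quiver.{0} Vertex := ⟨Arrow⟩

section Free

variable (K : Type u) [Field K]

/-- The path algebra of the quiver, before the relations are imposed. -/
abbrev P := PathAlg K Vertex

/-- The arrow `a` in the path algebra. -/
noncomputable def pa : P K := PathAlg.arrow K (i := Vertex.M) (j := Vertex.M) Arrow.a
/-- The arrow `b` in the path algebra. -/
noncomputable def pb : P K := PathAlg.arrow K (i := Vertex.M) (j := Vertex.M) Arrow.b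
/-- The arrow `c` in the path algebra. -/
noncomputable def pc : P K := PathAlg.arrow K (i := Vertex.M) (j := Vertex.R) Arrow.c
/-- The arrow `d` in the path algebra. -/
noncomputable def pd : P K := PathAlg.arrow K (i := Vertex.R) (j := Vertex.M) Arrow.d

end Free

variable (K : Type u) [Field K] (lam : K)

/-- The relations `(b² + dc)d = 0`, `c(b² + dc) = 0`, `ab + ba = 0` and
`a² + bdc + dcb + λb² + b³ = 0`. -/
inductive Rel : P K → P K → Prop
  | rel_c : Rel ((pb K ^ 2 + pd K * pc K) * pd K) 0
  | rel_d : Rel (pc K * (pb K ^ 2 + pd K * pc K)) 0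
  | rel_a : Rel (pa K * pb K + pb K * pa K) 0
  | rel_b : Rel (pa K ^ 2 + pb K * pd K * pc K + pd K * pc K * pb K + lam • pb K ^ 2 + pb K ^ 3) 0

/-- The Morrison–Pinkham quiver algebra: the path algebra modulo the two-sided ideal generated by
the relations. -/
abbrev A := RingQuot (Rel K lam)

/-- The quotient map from the path algebra. -/
noncomputable def quo : P K →ₐ[K] A K lam := RingQuot.mkAlgHom K (Rel K lam)

/-- The idempotent of a vertex in the quiver algebra. -/
noncomputable def e (i : Vertex) : A K lam := quo K lam (PathAlg.idem K i)
/-- The class of the loop `b`. -/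
noncomputable def b : A K lam := quo K lam (pb K)
/-- The class of the arrow `c`. -/
noncomputable def c : A K lam := quo K lam (pc K)
/-- The class of the arrow `d`. -/
noncomputable def d : A K lam := quo K lam (pd K)

theorem e_mul_e (i : Vertex) : e K lam i * e K lam i = e K lam i := by
  have h : PathAlg.idem K i * PathAlg.idem K i = PathAlg.idem K i := by
    simpa only [PathAlg.idem, map_mul] using RingQuot.mkAlgHom_rel K (PathRel.idem (K := K) i)
  simp only [e, ← map_mul, h]

theorem e_mul_arrow {i j : Vertex} (f : i ⟶ j) :
    e K lam j * quo K lam (PathAlg.arrow K f) = quo K lam (PathAlg.arrow K f) := by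
  have h : PathAlg.idem K j * PathAlg.arrow K f = PathAlg.arrow K f := by
    simpa only [PathAlg.idem, PathAlg.arrow, map_mul] using
      RingQuot.mkAlgHom_rel K (PathRel.target (K := K) f)
  simp only [e, ← map_mul, h]

theorem e_mul_b : e K lam Vertex.M * b K lam = b K lam := e_mul_arrow K lam _
theorem e_mul_c : e K lam Vertex.R * c K lam = c K lam := e_mul_arrow K lam _
theorem e_mul_d : e K lam Vertex.M * d K lam = d K lam := e_mul_arrow K lam _

/-- The right module `e_i A`, spanned by the paths that end at the vertex `i`. Right `A`-modules are
modules over the opposite algebra. -/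
noncomputable def Proj (i : Vertex) : Submodule (A K lam)ᵐᵒᵖ (A K lam) :=
  Submodule.span (A K lam)ᵐᵒᵖ {e K lam i}

theorem mem_Proj {i : Vertex} {x : A K lam} : x ∈ Proj K lam i ↔ e K lam i * x = x := by
  refine Submodule.mem_span_singleton.trans ⟨?_, fun h => ⟨MulOpposite.op x, h⟩⟩
  rintro ⟨y, rfl⟩
  rw [MulOpposite.smul_eq_mul_unop, ← mul_assoc, e_mul_e]

/-- Left multiplication by an element `g` with `e_j g = g`, as a homomorphism of right modules from
`e_i A` to `e_j A`. -/
noncomputable def leftMul (i : Vertex) {j : Vertex} (g : A K lam) (hg : e K lam j * g = g) :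
    Proj K lam i →ₗ[(A K lam)ᵐᵒᵖ] Proj K lam j where
  toFun x := ⟨g * x, by rw [mem_Proj, ← mul_assoc, hg]⟩
  map_add' x y := Subtype.ext (mul_add g x y)
  map_smul' r x := Subtype.ext (by simp [MulOpposite.smul_eq_mul_unop, mul_assoc])

/-- The map `e_R A → e_M A` given by `d`. -/
noncomputable def mapD : Proj K lam Vertex.R →ₗ[(A K lam)ᵐᵒᵖ] Proj K lam Vertex.M :=
  leftMul K lam Vertex.R (d K lam) (e_mul_d K lam)

/-- The map `e_M A → e_M A` given by `b² + dc`. -/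
noncomputable def mapB : Proj K lam Vertex.M →ₗ[(A K lam)ᵐᵒᵖ] Proj K lam Vertex.M :=
  leftMul K lam Vertex.M (b K lam ^ 2 + d K lam * c K lam)
    (by rw [mul_add, pow_two, ← mul_assoc, ← mul_assoc, e_mul_b, e_mul_d])

/-- The map `e_M A → e_R A` given by `c`. -/
noncomputable def mapC : Proj K lam Vertex.M →ₗ[(A K lam)ᵐᵒᵖ] Proj K lam Vertex.R :=
  leftMul K lam Vertex.M (c K lam) (e_mul_c K lam)

/-- The character through which `A` acts on the vertex simple at `i`: it sends `e_i` to `1` and the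
other vertex idempotent and all arrows to `0`. -/
noncomputable def char (i : Vertex) : A K lam →ₐ[K] K :=
  RingQuot.liftAlgHom K ⟨PathAlg.vertexChar K i, by
    intro x y h
    induction h <;> simp [pa, pb, pc, pd]⟩

/-- The vertex simple at `i`: the one-dimensional right `A`-module on which `x` acts as the scalar
`char i x`. -/
@[nolint unusedArguments]
def VertexSimple (K : Type u) [Field K] (_lam : K) (_i : Vertex) : Type u := K

noncomputable instance (i : Vertex) : AddCommGroup (VertexSimple K lam i) :=
  inferInstanceAs (AddCommGroup K)

noncomputable instance (i : Vertex) : Module (A K lam)ᵐᵒᵖ (VertexSimple K lam i) :=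
  Module.compHom K ((char K lam i).toRingHom.fromOpposite fun _ _ => mul_comm _ _)

/-- The canonical map `e_i A → L_i`, which sends `e_i` to `1`. -/
noncomputable def aug (i : Vertex) : Proj K lam i →ₗ[(A K lam)ᵐᵒᵖ] VertexSimple K lam i where
  toFun x := char K lam i x
  map_add' x y := map_add (char K lam i) (x : A K lam) y
  map_smul' r x := by
    change char K lam i ((x : A K lam) * r.unop) = char K lam i r.unop * char K lam i x
    rw [map_mul, mul_comm]

end MorrisonPinkham

/-!
The algebra contains a central polynomial ring `K[t, v, w]` with `t = b² - cd`. Over it, `a` and `b`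
generate in `e_M A e_M` a copy of the generalized quaternion algebra `H` with `a² = w - λt` and
`b² = t`. With `z = cabd` and `u = b² + dc`, the elements of `e_R A` are `p + sz + ck` for scalars
`p`, `s` and `k ∈ H`, and those of `e_M A` are `p + uq + sd` for `p, q, s ∈ H`. In these normal
forms left multiplication by `d`, `u` and `c` is triangular, and its essential entries are the
differentials of the Koszul complex of the regular sequence `t, w, v`, so the exactness of that
complex gives the exactness of the resolution. Collapse is ruled out by an explicit model of the
left module `A e_R` on `K[t, v, w]² ⊕ H`, in which `qd ≠ 0` for every nonzero `q ∈ H`.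
-/

namespace MorrisonPinkham

open RingTheory.Sequence
open scoped Quaternion

section RegularSequence

open MvPolynomial

theorem mem_span_X_image_of_X_mul_mem {σ R : Type*} [CommSemiring R] {s : Set σ} {i : σ}
    (hi : i ∉ s) {p : MvPolynomial σ R}
    (hp : X i * p ∈ Ideal.span (X '' s : Set (MvPolynomial σ R))) :
    p ∈ Ideal.span (X '' s : Set (MvPolynomial σ R)) := by
  rw [mem_ideal_span_X_image] at hp ⊢
  intro m hm
  obtain ⟨j, hj, hmj⟩ := hp (Finsupp.single i 1 + m) (by simpa using hm)
  have hij : i ≠ j := fun h => hi (h ▸ hj)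
  exact ⟨j, hj, by simpa [Finsupp.single_apply, hij] using hmj⟩

theorem ofList_map_X {σ R : Type*} [CommSemiring R] (l : List σ) :
    Ideal.ofList (l.map (X (R := R))) = Ideal.span (X '' {i | i ∈ l}) := by
  simp [Ideal.ofList, Set.image]

theorem isRegular_map_X {σ R : Type*} [CommRing R] [Nontrivial R] {l : List σ} (hl : l.Nodup) :
    IsRegular (MvPolynomial σ R) (l.map (X (R := R))) := by
  refine ⟨(isWeaklyRegular_iff_Fin _ _).2 fun i => ?_, fun h => ?_⟩
  · rw [smul_eq_mul, Ideal.mul_top, isSMulRegular_quotient_iff_mem_of_smul_mem, ← List.map_take,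
      ofList_map_X]
    intro p hp
    refine mem_span_X_image_of_X_mul_mem (fun hi => ?_) (by simpa using hp)
    obtain ⟨j, hj, hji⟩ := List.mem_take_iff_getElem.1 hi
    have hij := hl.getElem_inj_iff.1 hji
    omega
  · rw [smul_eq_mul, Ideal.mul_top, ofList_map_X, eq_comm, Ideal.eq_top_iff_one,
      mem_ideal_span_X_image] at h
    obtain ⟨i, -, hi⟩ := h 0 (by simp)
    exact hi rfl

theorem mem_idealOfVars_of_constantCoeff_eq_zero {σ R : Type*} [CommSemiring R]
    {p : MvPolynomial σ R} (hp : constantCoeff p = 0) : p ∈ idealOfVars σ R := by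
  rw [← pow_one (idealOfVars σ R), mem_pow_idealOfVars_iff']
  intro m hm
  obtain rfl : m = 0 := by simpa [Finsupp.degree_eq_zero_iff] using hm
  exact hp

variable {B : Type*} [CommRing B] {x y z : B}

theorem isWeaklyRegular_triple_iff : IsWeaklyRegular B [x, y, z] ↔
    (∀ p, x * p = 0 → p = 0) ∧ (∀ p, x ∣ y * p → x ∣ p) ∧
      ∀ p, z * p ∈ Ideal.span {x, y} → p ∈ Ideal.span {x, y} := by
  rw [isWeaklyRegular_iff_Fin]
  change (∀ i : Fin 3, _) ↔ _
  simp [Fin.forall_fin_succ, isSMulRegular_quotient_iff_mem_of_smul_mem, Ideal.ofList_cons,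
    Ideal.mem_span_singleton, ← Ideal.span_insert]

end RegularSequence

section Koszul

variable {B : Type*} [CommRing B] {α t : B} (v w : B)

/-- The first differential of the Koszul complex of `t, w, v`, on the coordinates `re`, `imI` and
`imJ` of a generalized quaternion algebra. -/
def koszulOne : ℍ[B,α,t] →ₗ[B] B where
  toFun q := v * q.imI - t * q.re - w * q.imJ
  map_add' p q := by simp only [QuaternionAlgebra.re_add, QuaternionAlgebra.imI_add,
    QuaternionAlgebra.imJ_add]; ring
  map_smul' s q := by simp only [QuaternionAlgebra.re_smul, QuaternionAlgebra.imI_smul,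
    QuaternionAlgebra.imJ_smul, smul_eq_mul, RingHom.id_apply]; ring

/-- The second differential of the Koszul complex of `t, w, v`, from the coordinates `imI`, `imJ`
and `imK` to the coordinates `re`, `imI` and `imJ`. -/
def koszulTwo : ℍ[B,α,t] →ₗ[B] ℍ[B,α,t] where
  toFun q := ⟨v * q.imI - w * q.imJ, t * q.imI + w * q.imK, t * q.imJ + v * q.imK, 0⟩
  map_add' p q := by ext <;> simp <;> ring
  map_smul' s q := by ext <;> simp <;> ring

/-- The generator of the image of the third differential of the Koszul complex of `t, w, v`, on the
coordinates `imI`, `imJ` and `imK`. -/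
def koszulThree : ℍ[B,α,t] := ⟨0, w, v, -t⟩

/-- The grade involution of the generalized quaternion algebra. -/
def involute (q : ℍ[B,α,t]) : ℍ[B,α,t] := ⟨q.re, -q.imI, -q.imJ, q.imK⟩

variable {v w}

theorem exists_im_eq_smul_koszulThree (h : IsWeaklyRegular B [t, w, v]) {q : ℍ[B,α,t]}
    (hq : koszulTwo v w q = 0) : ∃ s : B, q.im = s • koszulThree v w := by
  obtain ⟨ht, hw, -⟩ := isWeaklyRegular_triple_iff.1 h
  obtain ⟨-, hI, hJ, -⟩ := QuaternionAlgebra.ext_iff.1 hq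
  simp only [koszulTwo, LinearMap.coe_mk, AddHom.coe_mk, QuaternionAlgebra.imI_zero,
    QuaternionAlgebra.imJ_zero] at hI hJ
  obtain ⟨s, hs⟩ := hw q.imK ⟨-q.imI, by linear_combination hI⟩
  refine ⟨-s, QuaternionAlgebra.ext (by simp [koszulThree]) ?_ ?_
    (by simp [koszulThree, hs, mul_comm])⟩
  · simpa [koszulThree] using eq_neg_of_add_eq_zero_left
      (ht (q.imI + s * w) (by linear_combination hI - w * hs))
  · simpa [koszulThree] using eq_neg_of_add_eq_zero_left
      (ht (q.imJ + s * v) (by linear_combination hJ - v * hs))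

theorem exists_koszulTwo_eq (h : IsWeaklyRegular B [t, w, v]) {q : ℍ[B,α,t]}
    (hq : koszulOne v w q = 0) (hK : q.imK = 0) : ∃ p : ℍ[B,α,t], koszulTwo v w p = q := by
  obtain ⟨ht, hw, hv⟩ := isWeaklyRegular_triple_iff.1 h
  replace hq : v * q.imI - t * q.re - w * q.imJ = 0 := hq
  obtain ⟨p, r, hI⟩ := Ideal.mem_span_pair.1
    (hv q.imI (Ideal.mem_span_pair.2 ⟨q.re, q.imJ, by linear_combination -hq⟩))
  obtain ⟨s, hs⟩ := hw (q.imJ - v * r) ⟨v * p - q.re, by linear_combination -hq - v * hI⟩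
  refine ⟨⟨0, p, s, r⟩, QuaternionAlgebra.ext ?_ ?_ ?_ hK.symm⟩
  · exact sub_eq_zero.1 (ht (v * p - w * s - q.re) (by linear_combination hq + v * hI + w * hs))
  · change t * p + w * r = q.imI
    linear_combination hI
  · change t * s + v * r = q.imJ
    linear_combination -hs

theorem exists_koszulOne_eq {p : B} (hp : p ∈ Ideal.span {t, w, v}) (s : B) :
    ∃ q : ℍ[B,α,t], koszulOne v w q = p ∧ q.imK = s := by
  obtain ⟨x, y, z, rfl⟩ := Submodule.mem_span_triple.1 hp
  refine ⟨⟨-x, z, -y, s⟩, ?_, rfl⟩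
  simp only [koszulOne, LinearMap.coe_mk, AddHom.coe_mk, smul_eq_mul]
  ring

theorem eq_zero_of_forall_imK_mul {k : ℍ[B,α,t]} (hk : ∀ q, (k * q).imK = 0) : k = 0 := by
  have h₁ := hk 1
  have hI := hk ⟨0, 1, 0, 0⟩
  have hJ := hk ⟨0, 0, 1, 0⟩
  have hK := hk ⟨0, 0, 0, 1⟩
  ext <;> simp_all

theorem pow_three_ne_sq_of_isRegular (h : IsRegular B [t, w, v]) : t ^ 3 ≠ w ^ 2 := by
  intro heq
  obtain ⟨-, hw, -⟩ := isWeaklyRegular_triple_iff.1 h.toIsWeaklyRegular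
  have hunit : t ∣ 1 := hw 1 (by simpa using hw w ⟨t ^ 2, by linear_combination -heq⟩)
  refine h.top_ne_smul ?_
  rw [Ideal.ofList_cons, Ideal.span_singleton_eq_top.2 (isUnit_of_dvd_one hunit), top_sup_eq,
    smul_eq_mul, Ideal.mul_top]

theorem eq_zero_of_koszulTwo_mul [IsDomain B] (h : IsRegular B [t, w, v]) {q : ℍ[B,α,t]}
    (hq : ∀ p, koszulTwo v w (q * p) = 0) : q = 0 := by
  have imK_eq_zero {q : ℍ[B,α,t]} (h₁ : koszulTwo v w q = 0)
      (hj : koszulTwo v w (q * ⟨0, 0, 1, 0⟩) = 0) : q.imK = 0 := by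
    have hI : t * q.imI + w * q.imK = 0 := by
      simpa [koszulTwo] using congrArg QuaternionAlgebra.imI h₁
    have hI' : t * (t * q.imK) + w * q.imI = 0 := by
      simpa [koszulTwo] using congrArg QuaternionAlgebra.imI hj
    refine (mul_eq_zero.1 (?_ : (t ^ 3 - w ^ 2) * q.imK = 0)).resolve_left
      (sub_ne_zero.2 (pow_three_ne_sq_of_isRegular h))
    linear_combination t * hI' - w * hI
  exact eq_zero_of_forall_imK_mul fun p => imK_eq_zero (hq p) (by rw [mul_assoc]; exact hq _)

end Koszul

theorem mul_mul_of_eq {X : Type*} [Semigroup X] {x y z : X} (h : x * y = z) (w : X) :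
    x * (y * w) = z * w := by rw [← mul_assoc, h]

/-- The images in a ring `X` of the vertices and arrows of the Morrison–Pinkham quiver: idempotents
`r` and `m` for the vertices `R` and `M`, and elements `a`, `b`, `c`, `d` that start and end there
as the arrows do. -/
@[ext]
structure QuiverData (X : Type*) [Ring X] where
  (r m a b c d : X)
  r_add_m : r + m = 1
  r_mul_m : r * m = 0
  m_mul_a : m * a = a
  a_mul_m : a * m = a
  m_mul_b : m * b = b
  b_mul_m : b * m = b
  r_mul_c : r * c = c
  c_mul_m : c * m = c
  m_mul_d : m * d = d
  d_mul_r : d * r = d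

namespace QuiverData

variable {X : Type*} [Ring X] (S : QuiverData X)

theorem r_mul_r : S.r * S.r = S.r := by
  simpa [mul_add, S.r_mul_m] using congrArg (S.r * ·) S.r_add_m
theorem m_mul_m : S.m * S.m = S.m := by
  simpa [add_mul, S.r_mul_m] using congrArg (· * S.m) S.r_add_m
theorem m_mul_r : S.m * S.r = 0 := by
  simpa [add_mul, S.r_mul_r] using congrArg (· * S.r) S.r_add_m
theorem r_mul_a : S.r * S.a = 0 := by rw [← S.m_mul_a, mul_mul_of_eq S.r_mul_m, zero_mul]
theorem r_mul_b : S.r * S.b = 0 := by rw [← S.m_mul_b, mul_mul_of_eq S.r_mul_m, zero_mul]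
theorem r_mul_d : S.r * S.d = 0 := by rw [← S.m_mul_d, mul_mul_of_eq S.r_mul_m, zero_mul]
theorem m_mul_c : S.m * S.c = 0 := by rw [← S.r_mul_c, mul_mul_of_eq S.m_mul_r, zero_mul]
theorem a_mul_r : S.a * S.r = 0 := by rw [← S.a_mul_m, mul_assoc, S.m_mul_r, mul_zero]
theorem b_mul_r : S.b * S.r = 0 := by rw [← S.b_mul_m, mul_assoc, S.m_mul_r, mul_zero]
theorem c_mul_r : S.c * S.r = 0 := by rw [← S.c_mul_m, mul_assoc, S.m_mul_r, mul_zero]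
theorem d_mul_m : S.d * S.m = 0 := by rw [← S.d_mul_r, mul_assoc, S.r_mul_m, mul_zero]
theorem a_mul_c : S.a * S.c = 0 := by rw [← S.r_mul_c, mul_mul_of_eq S.a_mul_r, zero_mul]
theorem b_mul_c : S.b * S.c = 0 := by rw [← S.r_mul_c, mul_mul_of_eq S.b_mul_r, zero_mul]
theorem c_mul_c : S.c * S.c = 0 := by
  rw [← S.r_mul_c, mul_assoc, mul_mul_of_eq S.c_mul_r, zero_mul, mul_zero]
theorem d_mul_a : S.d * S.a = 0 := by rw [← S.m_mul_a, mul_mul_of_eq S.d_mul_m, zero_mul]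
theorem d_mul_b : S.d * S.b = 0 := by rw [← S.m_mul_b, mul_mul_of_eq S.d_mul_m, zero_mul]
theorem d_mul_d : S.d * S.d = 0 := by
  rw [← S.m_mul_d, mul_assoc, mul_mul_of_eq S.d_mul_m, zero_mul, mul_zero]

/-- The element `b² + dc` that defines the middle map of the resolution. -/
def u : X := S.b ^ 2 + S.d * S.c

theorem m_mul_u : S.m * S.u = S.u := by
  rw [u, mul_add, pow_two, ← mul_assoc, ← mul_assoc, S.m_mul_b, S.m_mul_d]

theorem u_mul_m : S.u * S.m = S.u := by
  rw [u, add_mul, pow_two, mul_assoc, mul_assoc, S.b_mul_m, S.c_mul_m]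

/-- The path `cabd`, which together with `e_R` generates `e_R A e_R` over the centre. -/
def z : X := S.c * (S.a * (S.b * S.d))

end QuiverData

/-- A realization of the Morrison–Pinkham quiver in an algebra over a commutative ring `B`, in which
the scalars `t`, `v`, `w` play the part of the central elements `b² - cd`,
`adc + dca + ab² + cad` and `-(bdc + dcb + b³ + cbd)` of the quiver algebra; there
`α = w - λt`. -/
structure CentralRealization {B : Type*} [CommRing B] (α t v w : B) (X : Type*) [Ring X]
    [Algebra B X] extends QuiverData X where
  a_mul_a : a * a = α • m
  b_mul_b : b * b = t • m
  b_mul_a : b * a = -(a * b)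
  c_mul_d : c * d = -(t • r)
  c_mul_a_mul_d : c * (a * d) = v • r
  c_mul_b_mul_d : c * (b * d) = -(w • r)
  a_mul_d_mul_c : a * (d * c) + d * (c * a) = v • m - t • a
  b_mul_d_mul_c : b * (d * c) + d * (c * b) = -(w • m) - t • b

namespace CentralRealization

variable {B : Type*} [CommRing B] {α t v w : B} {X : Type*} [Ring X] [Algebra B X]
  (S : CentralRealization α t v w X)

/-- The action of the generalized quaternion algebra with `i² = α` and `j² = t` on `X`: `i` acts as
`a` and `j` as `b`. It is multiplicative, with `1` sent to the idempotent `m`. -/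
def quat : ℍ[B,α,t] →ₗ[B] X where
  toFun q := q.re • S.m + q.imI • S.a + q.imJ • S.b + q.imK • (S.a * S.b)
  map_add' p q := by
    simp only [QuaternionAlgebra.re_add, QuaternionAlgebra.imI_add, QuaternionAlgebra.imJ_add,
      QuaternionAlgebra.imK_add]
    module
  map_smul' s q := by simp [mul_smul]

theorem quat_apply (q : ℍ[B,α,t]) :
    S.quat q = q.re • S.m + q.imI • S.a + q.imJ • S.b + q.imK • (S.a * S.b) := rfl

theorem quat_mul (p q : ℍ[B,α,t]) : S.quat (p * q) = S.quat p * S.quat q := by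
  simp only [quat_apply, QuaternionAlgebra.re_mul, QuaternionAlgebra.imI_mul,
    QuaternionAlgebra.imJ_mul, QuaternionAlgebra.imK_mul, add_mul, mul_add, smul_mul_assoc,
    mul_smul_comm, mul_assoc, S.m_mul_m, S.m_mul_a, S.m_mul_b, S.a_mul_m, S.b_mul_m, S.a_mul_a,
    S.b_mul_b, S.b_mul_a, mul_mul_of_eq S.m_mul_a, mul_mul_of_eq S.b_mul_a,
    mul_mul_of_eq S.a_mul_a, neg_mul, mul_neg]
  module

theorem quat_one : S.quat 1 = S.m := by simp [quat_apply]

theorem m_mul_quat (q : ℍ[B,α,t]) : S.m * S.quat q = S.quat q := by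
  rw [← S.quat_one, ← S.quat_mul, one_mul]

theorem quat_mul_m (q : ℍ[B,α,t]) : S.quat q * S.m = S.quat q := by
  rw [← S.quat_one, ← S.quat_mul, mul_one]

theorem quat_mul_r (q : ℍ[B,α,t]) : S.quat q * S.r = 0 := by
  rw [← S.quat_mul_m, mul_assoc, S.m_mul_r, mul_zero]

theorem quat_mul_c (q : ℍ[B,α,t]) : S.quat q * S.c = 0 := by
  rw [← S.quat_mul_m, mul_assoc, S.m_mul_c, mul_zero]

theorem quat_mul_a (q : ℍ[B,α,t]) : S.quat q * S.a = S.quat (q * ⟨0, 1, 0, 0⟩) := by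
  rw [S.quat_mul]; simp [quat_apply S ⟨0, 1, 0, 0⟩]

theorem quat_mul_b (q : ℍ[B,α,t]) : S.quat q * S.b = S.quat (q * ⟨0, 0, 1, 0⟩) := by
  rw [S.quat_mul]; simp [quat_apply S ⟨0, 0, 1, 0⟩]

theorem u_eq : S.u = t • S.m + S.d * S.c := by rw [QuiverData.u, pow_two, S.b_mul_b]

theorem u_mul_d : S.u * S.d = 0 := by
  simp [S.u_eq, add_mul, mul_assoc, S.m_mul_d, S.c_mul_d, S.d_mul_r]

theorem c_mul_u : S.c * S.u = 0 := by
  simp [S.u_eq, mul_add, S.c_mul_m, mul_mul_of_eq S.c_mul_d, S.r_mul_c]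

theorem u_mul_u : S.u * S.u = t • S.u := by
  nth_rw 2 [S.u_eq]
  rw [mul_add, ← mul_assoc, S.u_mul_d, zero_mul, add_zero, mul_smul_comm, S.u_mul_m]

theorem d_mul_z : S.d * S.z = S.quat (koszulThree v w) * S.d := by
  have hda : S.d * (S.c * S.a) = v • S.m - t • S.a - S.a * (S.d * S.c) :=
    eq_sub_of_add_eq' S.a_mul_d_mul_c
  calc S.d * S.z = (v • S.m - t • S.a - S.a * (S.d * S.c)) * (S.b * S.d) := by
        rw [← hda]; simp [QuiverData.z, mul_assoc]
    _ = S.quat (koszulThree v w) * S.d := by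
        simp [quat_apply, koszulThree, sub_mul, add_mul, mul_assoc, S.c_mul_b_mul_d, S.d_mul_r,
          mul_mul_of_eq S.m_mul_b]
        abel

theorem c_mul_quat_mul_d (q : ℍ[B,α,t]) :
    S.c * (S.quat q * S.d) = koszulOne v w q • S.r + q.imK • S.z := by
  simp [quat_apply, koszulOne, QuiverData.z, add_mul, mul_add, mul_assoc, S.m_mul_d, S.c_mul_d,
    S.c_mul_a_mul_d, S.c_mul_b_mul_d]
  module

theorem u_mul_quat_mul_d (q : ℍ[B,α,t]) :
    S.u * (S.quat q * S.d) = S.quat (koszulTwo v w q) * S.d := by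
  rw [S.u_eq, add_mul, smul_mul_assoc, mul_mul_of_eq (S.m_mul_quat q), mul_assoc,
    S.c_mul_quat_mul_d, mul_add, mul_smul_comm, mul_smul_comm, S.d_mul_z, S.d_mul_r]
  simp [quat_apply, koszulOne, koszulTwo, koszulThree, add_mul, mul_assoc, S.m_mul_d]
  module

theorem quat_mul_d_mul_c (q : ℍ[B,α,t]) : S.quat q * (S.d * S.c) =
    S.u * S.quat (involute q) +
      S.quat (koszulOne v w q • 1 + q.imK • involute (koszulThree v w)) := by
  have hadc : S.a * (S.d * S.c) = v • S.m - t • S.a - S.d * (S.c * S.a) :=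
    eq_sub_of_add_eq S.a_mul_d_mul_c
  have hbdc : S.b * (S.d * S.c) = -(w • S.m) - t • S.b - S.d * (S.c * S.b) :=
    eq_sub_of_add_eq S.b_mul_d_mul_c
  have hadcb : S.a * (S.d * (S.c * S.b)) =
      v • S.b - t • (S.a * S.b) - S.d * (S.c * (S.a * S.b)) := by
    simpa [mul_assoc, sub_mul, S.m_mul_b] using congrArg (· * S.b) hadc
  simp [S.u_eq, quat_apply, involute, koszulOne, koszulThree, add_mul, mul_add, mul_sub, mul_assoc,
    hadc, hbdc, hadcb, mul_mul_of_eq S.m_mul_d, S.m_mul_m, S.m_mul_a, S.m_mul_b,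
    mul_mul_of_eq S.m_mul_a, S.c_mul_m, S.a_mul_m]
  module

theorem c_mul_quat_mul_d_mul_c (q : ℍ[B,α,t]) : S.c * (S.quat q * (S.d * S.c)) =
    S.c * S.quat (koszulOne v w q • 1 + q.imK • involute (koszulThree v w)) := by
  rw [S.quat_mul_d_mul_c, mul_add, mul_mul_of_eq S.c_mul_u, zero_mul, zero_add]

theorem z_mul_c : S.z * S.c = S.c * S.quat (involute (koszulThree v w)) := by
  simpa [quat_apply S ⟨0, 0, 0, 1⟩, QuiverData.z, koszulOne, mul_assoc] using
    S.c_mul_quat_mul_d_mul_c ⟨0, 0, 0, 1⟩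

end CentralRealization

theorem mul_mem_of_adjoin_eq_top {B X : Type*} [CommSemiring B] [Semiring X] [Algebra B X]
    {s : Set X} (hs : Algebra.adjoin B s = ⊤) {N : Submodule B X}
    (hN : ∀ g ∈ s, ∀ x ∈ N, x * g ∈ N) {x : X} (hx : x ∈ N) (y : X) : x * y ∈ N := by
  have hy : y ∈ Algebra.adjoin B s := hs ▸ Algebra.mem_top
  induction hy using Algebra.adjoin_induction generalizing x with
  | mem g hg => exact hN g hg x hx
  | algebraMap p => rw [← Algebra.commutes, ← Algebra.smul_def]; exact N.smul_mem p hx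
  | add y z _ _ hy hz => rw [mul_add]; exact N.add_mem (hy hx) (hz hx)
  | mul y z _ _ hy hz => rw [← mul_assoc]; exact hz (hy hx)

/-- The set of all vertices and arrows. -/
def QuiverData.generators {X : Type*} [Ring X] (S : QuiverData X) : Set X :=
  {S.r, S.m, S.a, S.b, S.c, S.d}

namespace CentralRealization

variable {B : Type*} [CommRing B] {α t v w : B} {X : Type*} [Ring X] [Algebra B X]
  (S : CentralRealization α t v w X)

/-- The normal form of the elements of `e_R A`. -/
def normalR : (B × B) × ℍ[B,α,t] →ₗ[B] X :=
  ((LinearMap.toSpanSingleton B X S.r).coprod (LinearMap.toSpanSingleton B X S.z)).coprod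
    (LinearMap.mulLeft B S.c ∘ₗ S.quat)

/-- The normal form of the elements of `e_M A`. -/
def normalM : (ℍ[B,α,t] × ℍ[B,α,t]) × ℍ[B,α,t] →ₗ[B] X :=
  (S.quat.coprod (LinearMap.mulLeft B S.u ∘ₗ S.quat)).coprod
    (LinearMap.mulRight B S.d ∘ₗ S.quat)

theorem normalR_apply (p s : B) (k : ℍ[B,α,t]) :
    S.normalR ((p, s), k) = p • S.r + s • S.z + S.c * S.quat k := rfl

theorem normalM_apply (p q s : ℍ[B,α,t]) :
    S.normalM ((p, q), s) = S.quat p + S.u * S.quat q + S.quat s * S.d := rfl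

theorem normalR_mul_mem : ∀ g ∈ S.generators, ∀ x ∈ LinearMap.range S.normalR,
    x * g ∈ LinearMap.range S.normalR := by
  rintro _ (rfl | rfl | rfl | rfl | rfl | rfl) _ ⟨⟨⟨p, s⟩, k⟩, rfl⟩
  · refine ⟨((p, s), 0), ?_⟩
    simp [normalR_apply, QuiverData.z, add_mul, mul_assoc, S.r_mul_r, S.d_mul_r, S.quat_mul_r]
  · refine ⟨((0, 0), k), ?_⟩
    simp [normalR_apply, QuiverData.z, add_mul, mul_assoc, S.r_mul_m, S.d_mul_m, S.quat_mul_m]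
  · refine ⟨((0, 0), k * ⟨0, 1, 0, 0⟩), ?_⟩
    simp [normalR_apply, QuiverData.z, add_mul, mul_assoc, S.r_mul_a, S.d_mul_a, S.quat_mul_a]
  · refine ⟨((0, 0), k * ⟨0, 0, 1, 0⟩), ?_⟩
    simp [normalR_apply, QuiverData.z, add_mul, mul_assoc, S.r_mul_b, S.d_mul_b, S.quat_mul_b]
  · refine ⟨((0, 0), p • 1 + s • involute (koszulThree v w)), ?_⟩
    simp [normalR_apply, add_mul, mul_add, mul_assoc, S.r_mul_c, S.z_mul_c, S.quat_mul_c,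
      S.quat_one, S.c_mul_m]
  · refine ⟨((koszulOne v w k, k.imK), 0), ?_⟩
    simp [normalR_apply, QuiverData.z, add_mul, mul_assoc, S.r_mul_d, S.d_mul_d,
      S.c_mul_quat_mul_d]

theorem normalM_mul_mem : ∀ g ∈ S.generators, ∀ x ∈ LinearMap.range S.normalM,
    x * g ∈ LinearMap.range S.normalM := by
  rintro _ (rfl | rfl | rfl | rfl | rfl | rfl) _ ⟨⟨⟨p, q⟩, s⟩, rfl⟩
  · refine ⟨((0, 0), s), ?_⟩
    simp [normalM_apply, add_mul, mul_assoc, S.quat_mul_r, S.d_mul_r]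
  · refine ⟨((p, q), 0), ?_⟩
    simp [normalM_apply, add_mul, mul_assoc, S.quat_mul_m, S.d_mul_m]
  · refine ⟨((p * ⟨0, 1, 0, 0⟩, q * ⟨0, 1, 0, 0⟩), 0), ?_⟩
    simp [normalM_apply, add_mul, mul_assoc, S.quat_mul_a, S.d_mul_a]
  · refine ⟨((p * ⟨0, 0, 1, 0⟩, q * ⟨0, 0, 1, 0⟩), 0), ?_⟩
    simp [normalM_apply, add_mul, mul_assoc, S.quat_mul_b, S.d_mul_b]
  · refine ⟨((koszulOne v w s • 1 + s.imK • involute (koszulThree v w), involute s), 0), ?_⟩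
    simp [normalM_apply, add_mul, mul_assoc, S.quat_mul_c, S.quat_mul_d_mul_c, add_comm]
  · refine ⟨((0, 0), p + koszulTwo v w q), ?_⟩
    simp [normalM_apply, add_mul, mul_assoc, S.d_mul_d, S.u_mul_quat_mul_d]

variable {S} (hS : Algebra.adjoin B S.generators = ⊤)
include hS

theorem exists_eq_normalR {x : X} (hx : S.r * x = x) :
    ∃ (p s : B) (k : ℍ[B,α,t]), x = p • S.r + s • S.z + S.c * S.quat k := by
  have hr : S.r ∈ LinearMap.range S.normalR := ⟨((1, 0), 0), by simp [normalR_apply]⟩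
  obtain ⟨⟨⟨p, s⟩, k⟩, h⟩ := mul_mem_of_adjoin_eq_top hS S.normalR_mul_mem hr x
  exact ⟨p, s, k, by rw [← hx, ← h, normalR_apply]⟩

theorem exists_eq_normalM {x : X} (hx : S.m * x = x) :
    ∃ p q s : ℍ[B,α,t], x = S.quat p + S.u * S.quat q + S.quat s * S.d := by
  have hm : S.m ∈ LinearMap.range S.normalM := ⟨((1, 0), 0), by simp [normalM_apply, S.quat_one]⟩
  obtain ⟨⟨⟨p, q⟩, s⟩, h⟩ := mul_mem_of_adjoin_eq_top hS S.normalM_mul_mem hm x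
  exact ⟨p, q, s, by rw [← hx, ← h, normalM_apply]⟩

end CentralRealization

namespace CentralRealization

variable {B : Type*} [CommRing B] {α t v w : B} {X : Type*} [Ring X] [Algebra B X]
  {S : CentralRealization α t v w X}

section Faithful

variable (hd : ∀ q : ℍ[B,α,t], S.quat q * S.d = 0 → q = 0)
include hd

theorem eq_zero_of_d_mul_normalR (h : IsWeaklyRegular B [t, w, v]) {p s : B} {k : ℍ[B,α,t]}
    (hx : S.d * (p • S.r + s • S.z + S.c * S.quat k) = 0) :
    p = 0 ∧ s = 0 ∧ S.d * (S.c * S.quat k) = 0 := by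
  have hps : p • (1 : ℍ[B,α,t]) + s • koszulThree v w = 0 := by
    refine hd _ ?_
    simpa [mul_add, add_mul, mul_assoc, S.d_mul_r, S.d_mul_z, S.quat_mul_r, S.quat_one, S.m_mul_d]
      using congrArg (· * S.r) hx
  have hp : p = 0 := by simpa [koszulThree] using congrArg QuaternionAlgebra.re hps
  have hs : s = 0 := (isWeaklyRegular_triple_iff.1 h).1 s
    (by simpa [koszulThree, mul_comm] using congrArg QuaternionAlgebra.imK hps)
  exact ⟨hp, hs, by simpa [hp, hs] using hx⟩

theorem eq_zero_of_d_mul_c_mul_quat (h : IsWeaklyRegular B [t, w, v]) {k : ℍ[B,α,t]}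
    (hk : S.d * (S.c * S.quat k) = 0) : k = 0 := by
  refine eq_zero_of_forall_imK_mul fun q => ?_
  have hkq : S.d * (S.c * (S.quat (k * q) * S.d)) = 0 := by
    simpa [S.quat_mul, mul_assoc] using congrArg (· * (S.quat q * S.d)) hk
  refine (eq_zero_of_d_mul_normalR hd h (p := koszulOne v w (k * q)) (k := 0) ?_).2.1
  rw [← S.c_mul_quat_mul_d, map_zero, mul_zero, add_zero, hkq]

theorem eq_zero_of_u_mul_quat [IsDomain B] (h : IsRegular B [t, w, v]) {q : ℍ[B,α,t]}
    (hq : S.u * S.quat q = 0) : q = 0 := by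
  refine eq_zero_of_koszulTwo_mul h fun p => hd _ ?_
  rw [← S.u_mul_quat_mul_d, S.quat_mul, mul_assoc, mul_mul_of_eq hq, zero_mul]

variable (hS : Algebra.adjoin B S.generators = ⊤)
include hS

theorem eq_of_d_mul_eq (h : IsWeaklyRegular B [t, w, v]) {x y : X} (hx : S.r * x = x)
    (hy : S.r * y = y) (hxy : S.d * x = S.d * y) : x = y := by
  rw [← sub_eq_zero] at hxy ⊢
  obtain ⟨p, s, k, hk⟩ := exists_eq_normalR hS (x := x - y) (by rw [mul_sub, hx, hy])
  rw [← mul_sub, hk] at hxy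
  obtain ⟨rfl, rfl, hdk⟩ := eq_zero_of_d_mul_normalR hd h hxy
  simp [hk, eq_zero_of_d_mul_c_mul_quat hd h hdk]

theorem exists_d_mul_eq [IsDomain B] (h : IsRegular B [t, w, v]) {x : X} (hx : S.m * x = x)
    (hux : S.u * x = 0) : ∃ y, S.d * y = x := by
  obtain ⟨p, q, s, rfl⟩ := exists_eq_normalM hS hx
  have hux' : S.u * S.quat (p + t • q) + S.quat (koszulTwo v w s) * S.d = 0 := by
    simpa [mul_add, ← mul_assoc, S.u_mul_u, S.u_mul_quat_mul_d] using hux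
  have hs : koszulTwo v w s = 0 := hd _ <| by
    simpa [add_mul, mul_assoc, S.quat_mul_r, S.d_mul_r] using congrArg (· * S.r) hux'
  have hp : p + t • q = 0 := eq_zero_of_u_mul_quat hd h (by simpa [hs] using hux')
  obtain ⟨s', hs'⟩ := exists_im_eq_smul_koszulThree h.toIsWeaklyRegular hs
  refine ⟨S.c * S.quat q + s.re • S.r + s' • S.z, ?_⟩
  have hs_eq : s = s.re • 1 + s' • koszulThree v w := by rw [← hs']; ext <;> simp
  rw [eq_neg_of_add_eq_zero_left hp]
  nth_rw 2 [hs_eq]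
  simp [mul_add, add_mul, S.u_eq, S.d_mul_r, S.d_mul_z, S.quat_one, S.m_mul_d, S.m_mul_quat,
    mul_assoc]
  abel

theorem exists_u_mul_eq (h : IsWeaklyRegular B [t, w, v]) {x : X} (hx : S.m * x = x)
    (hcx : S.c * x = 0) : ∃ y, S.u * y = x := by
  obtain ⟨p, q, s, rfl⟩ := exists_eq_normalM hS hx
  have hcx' : koszulOne v w s • S.r + s.imK • S.z + S.c * S.quat p = 0 := by
    simpa [mul_add, mul_mul_of_eq S.c_mul_u, S.c_mul_quat_mul_d, add_comm] using hcx
  obtain ⟨h₁, hK, hp⟩ := eq_zero_of_d_mul_normalR hd h (by rw [hcx', mul_zero])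
  obtain ⟨k, rfl⟩ := exists_koszulTwo_eq h h₁ hK
  refine ⟨S.quat q + S.quat k * S.d, ?_⟩
  simp [eq_zero_of_d_mul_c_mul_quat hd h hp, mul_add, S.u_mul_quat_mul_d]

end Faithful

theorem exists_c_mul_eq (hS : Algebra.adjoin B S.generators = ⊤) {L : Type*} [Ring L]
    (χ : X →+* L) (hr : χ S.r = 1) (hc : χ S.c = 0)
    (hχ : ∀ p, χ (algebraMap B X p) = 0 → p ∈ Ideal.span {t, w, v}) {x : X} (hx : S.r * x = x)
    (hχx : χ x = 0) : ∃ y, S.c * y = x := by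
  obtain ⟨p, s, k, rfl⟩ := exists_eq_normalR hS hx
  have hp : χ (algebraMap B X p) = 0 := by
    simpa [Algebra.smul_def, hr, hc, QuiverData.z] using hχx
  obtain ⟨q, rfl, rfl⟩ := exists_koszulOne_eq (α := α) (hχ p hp) s
  exact ⟨S.quat q * S.d + S.quat k, by rw [mul_add, S.c_mul_quat_mul_d]⟩

end CentralRealization

section Model

variable {B : Type*} [CommRing B] (α t v w : B)

/-- The action of the quiver on `(B × B) × ℍ[B,α,t]`, to be thought of as the left module `A e_R`:
the elements `(p, s)` and `q` stand for `p + s z ∈ e_R A e_R` and `q d ∈ e_M A e_R`. -/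
def modelData : QuiverData (Module.End B ((B × B) × ℍ[B,α,t])) where
  r := LinearMap.inl _ _ _ ∘ₗ LinearMap.fst _ _ _
  m := LinearMap.inr _ _ _ ∘ₗ LinearMap.snd _ _ _
  a := LinearMap.inr _ _ _ ∘ₗ LinearMap.mulLeft B ⟨0, 1, 0, 0⟩ ∘ₗ LinearMap.snd _ _ _
  b := LinearMap.inr _ _ _ ∘ₗ LinearMap.mulLeft B ⟨0, 0, 1, 0⟩ ∘ₗ LinearMap.snd _ _ _
  c := LinearMap.inl _ _ _ ∘ₗ ((koszulOne v w).prod (QuaternionAlgebra.imKₗ _ _ _)) ∘ₗ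
    LinearMap.snd _ _ _
  d := LinearMap.inr _ _ _ ∘ₗ ((LinearMap.toSpanSingleton B _ 1).coprod
    (LinearMap.toSpanSingleton B _ (koszulThree v w))) ∘ₗ LinearMap.fst _ _ _
  r_add_m := by ext <;> simp
  r_mul_m := by ext <;> simp
  m_mul_a := rfl
  a_mul_m := rfl
  m_mul_b := rfl
  b_mul_m := rfl
  r_mul_c := rfl
  c_mul_m := rfl
  m_mul_d := rfl
  d_mul_r := rfl

@[simp] theorem modelData_r_apply (x : (B × B) × ℍ[B,α,t]) :
    (modelData α t v w).r x = (x.1, 0) := rfl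
@[simp] theorem modelData_m_apply (x : (B × B) × ℍ[B,α,t]) :
    (modelData α t v w).m x = (0, x.2) := rfl
@[simp] theorem modelData_a_apply (x : (B × B) × ℍ[B,α,t]) :
    (modelData α t v w).a x = (0, ⟨0, 1, 0, 0⟩ * x.2) := rfl
@[simp] theorem modelData_b_apply (x : (B × B) × ℍ[B,α,t]) :
    (modelData α t v w).b x = (0, ⟨0, 0, 1, 0⟩ * x.2) := rfl
@[simp] theorem modelData_c_apply (x : (B × B) × ℍ[B,α,t]) :
    (modelData α t v w).c x = ((koszulOne v w x.2, x.2.imK), 0) := rfl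
@[simp] theorem modelData_d_apply (x : (B × B) × ℍ[B,α,t]) :
    (modelData α t v w).d x = (0, x.1.1 • 1 + x.1.2 • koszulThree v w) := rfl

/-- The model of the quiver algebra, in which `q d` is visibly nonzero for `q ≠ 0`. -/
def model : CentralRealization α t v w (Module.End B ((B × B) × ℍ[B,α,t])) where
  __ := modelData α t v w
  a_mul_a := by
    refine LinearMap.ext fun x => ?_
    ext <;> simp
  b_mul_b := by
    refine LinearMap.ext fun x => ?_
    ext <;> simp
  b_mul_a := by
    refine LinearMap.ext fun x => ?_
    ext <;> simp
    ring
  c_mul_d := by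
    refine LinearMap.ext fun x => ?_
    ext <;> simp [koszulOne, koszulThree] <;> ring
  c_mul_a_mul_d := by
    refine LinearMap.ext fun x => ?_
    ext <;> simp [koszulOne, koszulThree] <;> ring
  c_mul_b_mul_d := by
    refine LinearMap.ext fun x => ?_
    ext <;> simp [koszulOne, koszulThree] <;> ring
  a_mul_d_mul_c := by
    refine LinearMap.ext fun x => ?_
    ext <;> simp [koszulOne, koszulThree] <;> ring
  b_mul_d_mul_c := by
    refine LinearMap.ext fun x => ?_
    ext <;> simp [koszulOne, koszulThree] <;> ring

theorem model_quat_mul_d_apply (q : ℍ[B,α,t]) :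
    ((model α t v w).quat q * (model α t v w).d) ((1, 0), 0) = (0, q) := by
  rw [CentralRealization.quat_apply]
  ext <;> simp [model, modelData]

theorem model_eq_zero_of_quat_mul_d {q : ℍ[B,α,t]}
    (hq : (model α t v w).quat q * (model α t v w).d = 0) : q = 0 := by
  simpa [hq] using (congrArg Prod.snd (model_quat_mul_d_apply α t v w q)).symm

end Model

theorem mul_mul_mul_of_eq {X : Type*} [Semigroup X] {x y y' z : X} (h : x * (y * y') = z) (w : X) :
    x * (y * (y' * w)) = z * w := by rw [← h, mul_assoc, mul_assoc]

namespace QuiverData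

variable {X Y : Type*} [Ring X] [Ring Y] (S : QuiverData X)

/-- The image of a realization of the quiver under a ring homomorphism. -/
def map (φ : X →+* Y) : QuiverData Y where
  r := φ S.r
  m := φ S.m
  a := φ S.a
  b := φ S.b
  c := φ S.c
  d := φ S.d
  r_add_m := by rw [← map_add, S.r_add_m, map_one]
  r_mul_m := by rw [← map_mul, S.r_mul_m, map_zero]
  m_mul_a := by rw [← map_mul, S.m_mul_a]
  a_mul_m := by rw [← map_mul, S.a_mul_m]
  m_mul_b := by rw [← map_mul, S.m_mul_b]
  b_mul_m := by rw [← map_mul, S.b_mul_m]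
  r_mul_c := by rw [← map_mul, S.r_mul_c]
  c_mul_m := by rw [← map_mul, S.c_mul_m]
  m_mul_d := by rw [← map_mul, S.m_mul_d]
  d_mul_r := by rw [← map_mul, S.d_mul_r]

/-- The central element `t` of the quiver algebra. -/
def centT : X := S.b * S.b - S.c * S.d

/-- The central element `v` of the quiver algebra. -/
def centV : X :=
  S.a * (S.d * S.c) + S.d * (S.c * S.a) + S.a * (S.b * S.b) + S.c * (S.a * S.d)

/-- The central element `w` of the quiver algebra. -/
def centW : X :=
  -(S.b * (S.d * S.c) + S.d * (S.c * S.b) + S.b * (S.b * S.b)) - S.c * (S.b * S.d)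

theorem map_centT (φ : X →+* Y) : φ S.centT = (S.map φ).centT := by simp [centT, map]
theorem map_centV (φ : X →+* Y) : φ S.centV = (S.map φ).centV := by simp [centV, map]
theorem map_centW (φ : X →+* Y) : φ S.centW = (S.map φ).centW := by simp [centW, map]

theorem centT_mul_r : S.centT * S.r = -(S.c * S.d) := by
  simp [centT, sub_mul, mul_assoc, S.b_mul_r, S.d_mul_r]
theorem centT_mul_m : S.centT * S.m = S.b * S.b := by
  simp [centT, sub_mul, mul_assoc, S.b_mul_m, S.d_mul_m]
theorem centV_mul_r : S.centV * S.r = S.c * (S.a * S.d) := by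
  simp [centV, add_mul, mul_assoc, S.a_mul_r, S.b_mul_r, S.c_mul_r, S.d_mul_r]
theorem centV_mul_m :
    S.centV * S.m = S.a * (S.d * S.c) + S.d * (S.c * S.a) + S.a * (S.b * S.b) := by
  simp [centV, add_mul, mul_assoc, S.a_mul_m, S.b_mul_m, S.c_mul_m, S.d_mul_m]
theorem centW_mul_r : S.centW * S.r = -(S.c * (S.b * S.d)) := by
  simp [centW, sub_mul, add_mul, mul_assoc, S.b_mul_r, S.c_mul_r, S.d_mul_r]
theorem centW_mul_m :
    S.centW * S.m = -(S.b * (S.d * S.c) + S.d * (S.c * S.b) + S.b * (S.b * S.b)) := by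
  simp [centW, sub_mul, add_mul, mul_assoc, S.b_mul_m, S.c_mul_m, S.d_mul_m]

theorem r_mul_centT : S.r * S.centT = -(S.c * S.d) := by
  simp [centT, mul_sub, mul_mul_of_eq S.r_mul_b, mul_mul_of_eq S.r_mul_c]
theorem r_mul_centV : S.r * S.centV = S.c * (S.a * S.d) := by
  simp [centV, mul_add, mul_mul_of_eq S.r_mul_a, mul_mul_of_eq S.r_mul_c,
    mul_mul_of_eq S.r_mul_d]
theorem r_mul_centW : S.r * S.centW = -(S.c * (S.b * S.d)) := by
  simp [centW, mul_sub, mul_add, mul_mul_of_eq S.r_mul_b, mul_mul_of_eq S.r_mul_c,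
    mul_mul_of_eq S.r_mul_d]
theorem m_mul_centW :
    S.m * S.centW = -(S.b * (S.d * S.c) + S.d * (S.c * S.b) + S.b * (S.b * S.b)) := by
  simp [centW, mul_sub, mul_add, mul_mul_of_eq S.m_mul_b, mul_mul_of_eq S.m_mul_c,
    mul_mul_of_eq S.m_mul_d]

variable {S}

theorem mem_center_of_commute {K : Type*} [CommSemiring K] [Algebra K X]
    (hS : Algebra.adjoin K S.generators = ⊤) {x : X} (hr : x * S.r = S.r * x)
    (ha : x * S.a = S.a * x) (hb : x * S.b = S.b * x) (hc : x * S.c = S.c * x)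
    (hd : x * S.d = S.d * x) : x ∈ Subalgebra.center K X := by
  have hm : x * S.m = S.m * x := by
    rw [eq_sub_of_add_eq' S.r_add_m, mul_sub, sub_mul, hr, mul_one, one_mul]
  have htop : Subalgebra.centralizer K {x} = ⊤ := by
    rw [eq_top_iff, ← hS, Algebra.adjoin_le_iff]
    rintro y (rfl | rfl | rfl | rfl | rfl | rfl) <;>
      simpa [Subalgebra.mem_centralizer_iff, Set.mem_centralizer_iff]
  exact (Subalgebra.centralizer_eq_top_iff_subset K).1 htop rfl

end QuiverData

/-- A realization of the Morrison–Pinkham quiver with its relations in an algebra over `K`. -/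
structure Realization {K : Type*} [CommRing K] (lam : K) (X : Type*) [Ring X] [Algebra K X]
    extends QuiverData X where
  u_mul_d : toQuiverData.u * d = 0
  c_mul_u : c * toQuiverData.u = 0
  a_mul_b_add_b_mul_a : a * b + b * a = 0
  a_sq_add : a ^ 2 + b * d * c + d * c * b + lam • b ^ 2 + b ^ 3 = 0

namespace Realization

variable {K : Type*} [CommRing K] {lam : K} {X : Type*} [Ring X] [Algebra K X]
  (S : Realization lam X)

theorem b_mul_b_mul_d : S.b * (S.b * S.d) = -(S.d * (S.c * S.d)) :=
  eq_neg_of_add_eq_zero_left <| by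
    simpa [QuiverData.u, pow_two, add_mul, mul_assoc] using S.u_mul_d

theorem c_mul_b_mul_b : S.c * (S.b * S.b) = -(S.c * (S.d * S.c)) :=
  eq_neg_of_add_eq_zero_left <| by simpa [QuiverData.u, pow_two, mul_add] using S.c_mul_u

theorem b_mul_a : S.b * S.a = -(S.a * S.b) :=
  eq_neg_of_add_eq_zero_right S.a_mul_b_add_b_mul_a

theorem a_mul_a : S.a * S.a = -(S.b * (S.d * S.c) + S.d * (S.c * S.b) + S.b * (S.b * S.b)) -
    lam • (S.b * S.b) := by
  rw [← sub_eq_zero, ← S.a_sq_add]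
  simp only [pow_succ, pow_zero, one_mul, mul_assoc]
  abel

theorem a_mul_b_mul_b : S.a * (S.b * S.b) = S.b * (S.b * S.a) := by
  rw [S.b_mul_a, mul_neg, mul_mul_of_eq S.b_mul_a, neg_mul, neg_neg, mul_assoc]

theorem centW_mul_a : S.centW * S.a = S.a * S.centW := by
  have h : S.centW * S.m = S.a * S.a + lam • (S.b * S.b) := by
    rw [S.centW_mul_m, S.a_mul_a, sub_add_cancel]
  calc S.centW * S.a = S.centW * S.m * S.a := by rw [mul_assoc, S.m_mul_a]
    _ = S.a * (S.centW * S.m) := by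
      rw [h]; simp [add_mul, mul_add, mul_assoc, S.a_mul_b_mul_b]
    _ = S.a * S.centW := by
      rw [S.centW_mul_m, ← S.m_mul_centW, ← mul_assoc, S.a_mul_m]

theorem centV_mul_a : S.centV * S.a = S.a * S.centV := by
  simp only [QuiverData.centV, add_mul, mul_add, mul_assoc, S.d_mul_a, mul_mul_of_eq S.a_mul_c,
    mul_zero, zero_mul, ← S.a_mul_b_mul_b]
  simp [mul_mul_of_eq S.a_mul_a, S.a_mul_a, add_mul, mul_add, sub_mul, mul_sub, mul_assoc,
    S.c_mul_b_mul_b, mul_mul_mul_of_eq S.c_mul_b_mul_b, mul_mul_mul_of_eq S.b_mul_b_mul_d]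
  abel

theorem centV_mul_b : S.centV * S.b = S.b * S.centV := by
  have h : S.a * (S.b * (S.d * S.c)) + S.a * (S.d * (S.c * S.b)) + S.a * (S.b * (S.b * S.b)) =
      S.b * (S.d * (S.c * S.a)) + S.d * (S.c * (S.b * S.a)) + S.b * (S.b * (S.b * S.a)) := by
    simpa [QuiverData.centW, sub_mul, mul_sub, add_mul, mul_add, mul_assoc, S.d_mul_a,
      mul_mul_of_eq S.a_mul_c, ← neg_add_rev, add_comm, add_left_comm] using S.centW_mul_a.symm
  simp only [S.b_mul_a, mul_mul_of_eq S.b_mul_a, mul_neg, neg_mul, neg_neg, mul_assoc] at h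
  simp only [QuiverData.centV, add_mul, mul_add, mul_assoc, S.d_mul_b, mul_mul_of_eq S.b_mul_c,
    mul_mul_of_eq S.b_mul_a, neg_mul, mul_zero, zero_mul, add_zero]
  linear_combination (norm := abel) h

section Center

variable {S} (hS : Algebra.adjoin K S.generators = ⊤)
include hS

theorem centT_mem_center : S.centT ∈ Subalgebra.center K X := by
  apply QuiverData.mem_center_of_commute hS
  · rw [S.centT_mul_r, S.r_mul_centT]
  · simp [QuiverData.centT, sub_mul, mul_sub, mul_assoc, S.d_mul_a, mul_mul_of_eq S.a_mul_c,
      S.a_mul_b_mul_b]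
  · simp [QuiverData.centT, sub_mul, mul_sub, mul_assoc, S.d_mul_b, mul_mul_of_eq S.b_mul_c]
  · simp [QuiverData.centT, sub_mul, mul_sub, mul_assoc, S.b_mul_c, mul_mul_of_eq S.c_mul_c,
      S.c_mul_b_mul_b]
  · simp [QuiverData.centT, sub_mul, mul_sub, mul_assoc, S.d_mul_d, S.b_mul_b_mul_d,
      mul_mul_of_eq S.d_mul_b]

theorem centV_mem_center : S.centV ∈ Subalgebra.center K X := by
  apply QuiverData.mem_center_of_commute hS
  · rw [S.centV_mul_r, S.r_mul_centV]
  · exact S.centV_mul_a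
  · exact S.centV_mul_b
  · simp [QuiverData.centV, add_mul, mul_add, mul_assoc, S.a_mul_c, S.c_mul_c,
      mul_mul_of_eq S.c_mul_c, S.a_mul_b_mul_b, mul_mul_mul_of_eq S.c_mul_b_mul_b]
  · simp [QuiverData.centV, add_mul, mul_add, mul_assoc, S.d_mul_d, mul_mul_of_eq S.d_mul_d,
      mul_mul_of_eq S.d_mul_a, S.b_mul_b_mul_d]

theorem centW_mem_center : S.centW ∈ Subalgebra.center K X := by
  apply QuiverData.mem_center_of_commute hS
  · rw [S.centW_mul_r, S.r_mul_centW]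
  · exact S.centW_mul_a
  · simp [QuiverData.centW, sub_mul, mul_sub, add_mul, mul_add, mul_assoc, S.d_mul_b,
      mul_mul_of_eq S.b_mul_c, mul_mul_mul_of_eq S.b_mul_b_mul_d, S.c_mul_b_mul_b]
    abel
  · simp [QuiverData.centW, sub_mul, mul_sub, add_mul, mul_add, mul_assoc, S.b_mul_c, S.c_mul_c,
      mul_mul_of_eq S.c_mul_c, mul_mul_mul_of_eq S.c_mul_b_mul_b]
  · simp [QuiverData.centW, sub_mul, mul_sub, add_mul, mul_add, mul_assoc, S.d_mul_d,
      mul_mul_of_eq S.d_mul_d, mul_mul_of_eq S.d_mul_b, S.b_mul_b_mul_d]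

end Center

/-- The homomorphism `K[t, v, w] → Z(X)` given by the central elements. -/
noncomputable def toCenter (hS : Algebra.adjoin K S.generators = ⊤) :
    MvPolynomial (Fin 3) K →ₐ[K] Subalgebra.center K X :=
  MvPolynomial.aeval
    ![⟨S.centT, centT_mem_center hS⟩, ⟨S.centV, centV_mem_center hS⟩,
      ⟨S.centW, centW_mem_center hS⟩]

/-- The `K[t, v, w]`-algebra structure given by the central elements. -/
noncomputable abbrev algebraMvPolynomial (hS : Algebra.adjoin K S.generators = ⊤) :
    Algebra (MvPolynomial (Fin 3) K) X :=
  ((Subalgebra.center K X).val.comp (S.toCenter hS)).toRingHom.toAlgebra' fun p x =>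
    (Subalgebra.mem_center_iff.1 (S.toCenter hS p).2 x).symm

variable {B : Type*} [CommRing B] [Algebra B X] {t v w : B}

/-- A realization over `K` is a central realization over any algebra `B` whose elements `t`, `v`,
`w` act as the central elements. -/
def toCentral [Algebra K B] [IsScalarTower K B X] (ht : algebraMap B X t = S.centT)
    (hv : algebraMap B X v = S.centV) (hw : algebraMap B X w = S.centW) :
    CentralRealization (w - lam • t) t v w X :=
  have t_smul_m : t • S.m = S.b * S.b := by rw [Algebra.smul_def, ht, S.centT_mul_m]
  have w_smul_m : w • S.m = -(S.b * (S.d * S.c) + S.d * (S.c * S.b) + S.b * (S.b * S.b)) := by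
    rw [Algebra.smul_def, hw, S.centW_mul_m]
  have t_smul_a : t • S.a = S.a * (S.b * S.b) := by
    rw [← t_smul_m, mul_smul_comm, S.a_mul_m]
  have t_smul_b : t • S.b = S.b * (S.b * S.b) := by
    rw [← t_smul_m, mul_smul_comm, S.b_mul_m]
  { S.toQuiverData with
    a_mul_a := by rw [sub_smul, smul_assoc, t_smul_m, w_smul_m, S.a_mul_a]
    b_mul_b := t_smul_m.symm
    b_mul_a := S.b_mul_a
    c_mul_d := by rw [Algebra.smul_def, ht, S.centT_mul_r, neg_neg]
    c_mul_a_mul_d := by rw [Algebra.smul_def, hv, S.centV_mul_r]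
    c_mul_b_mul_d := by rw [Algebra.smul_def, hw, S.centW_mul_r, neg_neg]
    a_mul_d_mul_c := by
      rw [Algebra.smul_def, hv, S.centV_mul_m, t_smul_a, add_sub_cancel_right]
    b_mul_d_mul_c := by rw [w_smul_m, t_smul_b, neg_neg, add_sub_cancel_right] }

end Realization

namespace CentralRealization

variable {B : Type*} [CommRing B] {α t v w : B} {X : Type*} [Ring X] [Algebra B X]

section

variable (S : CentralRealization α t v w X)

theorem algebraMap_t : algebraMap B X t = S.centT := by
  rw [Algebra.algebraMap_eq_smul_one, ← S.r_add_m, QuiverData.centT, S.b_mul_b, S.c_mul_d]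
  module

theorem algebraMap_v : algebraMap B X v = S.centV := by
  rw [Algebra.algebraMap_eq_smul_one, ← S.r_add_m, QuiverData.centV, S.a_mul_d_mul_c,
    S.c_mul_a_mul_d, S.b_mul_b, mul_smul_comm, S.a_mul_m]
  module

theorem algebraMap_w : algebraMap B X w = S.centW := by
  rw [Algebra.algebraMap_eq_smul_one, ← S.r_add_m, QuiverData.centW, S.b_mul_d_mul_c,
    S.c_mul_b_mul_d, S.b_mul_b, mul_smul_comm, S.b_mul_m]
  module

end

/-- A central realization over a `K`-algebra `B` with `α = w - λt` is a realization over `K`. -/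
def toRealization {K : Type*} [CommRing K] [Algebra K B] [Algebra K X] [IsScalarTower K B X]
    {lam : K} (S : CentralRealization (w - lam • t) t v w X) : Realization lam X where
  __ := S.toQuiverData
  u_mul_d := S.u_mul_d
  c_mul_u := S.c_mul_u
  a_mul_b_add_b_mul_a := by rw [S.b_mul_a, add_neg_cancel]
  a_sq_add := by
    have h := S.b_mul_d_mul_c
    rw [pow_succ S.b 2, pow_two, pow_two, S.a_mul_a, S.b_mul_b, smul_mul_assoc, S.m_mul_b,
      mul_assoc, mul_assoc, add_assoc (_ • S.m), h, sub_smul, smul_assoc]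
    abel

theorem eq_zero_of_quat_mul_d {Y : Type*} [Ring Y] [Algebra B Y] (S : CentralRealization α t v w X)
    (T : CentralRealization α t v w Y) (φ : X →ₐ[B] Y) (hφ : S.map φ = T.toQuiverData)
    (hT : ∀ q, T.quat q * T.d = 0 → q = 0) {q} (hq : S.quat q * S.d = 0) : q = 0 := by
  have ha : φ S.a = T.a := congrArg QuiverData.a hφ
  have hb : φ S.b = T.b := congrArg QuiverData.b hφ
  have hm : φ S.m = T.m := congrArg QuiverData.m hφ
  have hd : φ S.d = T.d := congrArg QuiverData.d hφ
  exact hT q (by simpa [quat_apply, ha, hb, hm, hd] using congrArg φ hq)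

end CentralRealization

section PathAlgebra

variable {K : Type u} [Field K] {lam : K} {X : Type v} [Ring X]

/-- The values of a realization of the quiver on the generators of the path algebra. -/
def QuiverData.gen (S : QuiverData X) : PathGen Vertex → X
  | PathGen.vertex Vertex.R => S.r
  | PathGen.vertex Vertex.M => S.m
  | PathGen.arrow Arrow.a => S.a
  | PathGen.arrow Arrow.b => S.b
  | PathGen.arrow Arrow.c => S.c
  | PathGen.arrow Arrow.d => S.d

variable [Algebra K X]

/-- The representation of the path algebra given by a realization of the quiver. -/
noncomputable def QuiverData.liftPath (S : QuiverData X) : P K →ₐ[K] X :=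
  RingQuot.liftAlgHom K ⟨FreeAlgebra.lift K S.gen, by
    intro x y h
    induction h with
    | idem i => cases i <;> simp [gen, S.r_mul_r, S.m_mul_m]
    | orth i j h => cases i <;> cases j <;> simp [gen, S.r_mul_m, S.m_mul_r] at h ⊢
    | one =>
      rw [show (Finset.univ : Finset Vertex) = {Vertex.R, Vertex.M} from rfl,
        Finset.sum_pair (by decide)]
      simp [gen, S.r_add_m]
    | @target i j f =>
      change Arrow i j at f
      cases f <;> simp [gen, S.m_mul_a, S.m_mul_b, S.r_mul_c, S.m_mul_d]
    | @source i j f =>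
      change Arrow i j at f
      cases f <;> simp [gen, S.a_mul_m, S.b_mul_m, S.c_mul_m, S.d_mul_r]⟩

namespace QuiverData

variable (S : QuiverData X)

theorem liftPath_idem (i : Vertex) :
    S.liftPath (PathAlg.idem K i) = S.gen (PathGen.vertex i) := by
  simp [liftPath, PathAlg.idem]

theorem liftPath_arrow {i j : Vertex} (f : i ⟶ j) :
    S.liftPath (PathAlg.arrow K f) = S.gen (PathGen.arrow f) := by
  simp [liftPath, PathAlg.arrow]

theorem liftPath_pa : S.liftPath (pa K) = S.a := S.liftPath_arrow _
theorem liftPath_pb : S.liftPath (pb K) = S.b := S.liftPath_arrow _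
theorem liftPath_pc : S.liftPath (pc K) = S.c := S.liftPath_arrow _
theorem liftPath_pd : S.liftPath (pd K) = S.d := S.liftPath_arrow _

end QuiverData

/-- The homomorphism from the quiver algebra given by a realization. -/
noncomputable def Realization.lift (S : Realization lam X) : A K lam →ₐ[K] X :=
  RingQuot.liftAlgHom K ⟨S.liftPath, by
    intro x y h
    cases h <;> simp only [map_add, map_mul, map_pow, map_smul, map_zero, S.liftPath_pa,
      S.liftPath_pb, S.liftPath_pc, S.liftPath_pd]
    exacts [S.u_mul_d, S.c_mul_u, S.a_mul_b_add_b_mul_a, S.a_sq_add]⟩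

theorem Realization.lift_quo (S : Realization lam X) (x : P K) :
    S.lift (quo K lam x) = S.liftPath x := by
  simp [lift, quo]

end PathAlgebra

section QuiverAlgebra

variable (K : Type u) [Field K] (lam : K)

theorem arrow_mul_e {i j : Vertex} (f : i ⟶ j) :
    quo K lam (PathAlg.arrow K f) * e K lam i = quo K lam (PathAlg.arrow K f) := by
  have h : PathAlg.arrow K f * PathAlg.idem K i = PathAlg.arrow K f := by
    simpa only [PathAlg.idem, PathAlg.arrow, map_mul] using
      RingQuot.mkAlgHom_rel K (PathRel.source (K := K) f)
  simp only [e, ← map_mul, h]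

theorem e_mul_e_of_ne {i j : Vertex} (hij : i ≠ j) : e K lam i * e K lam j = 0 := by
  have h : PathAlg.idem K i * PathAlg.idem K j = 0 := by
    simpa only [PathAlg.idem, map_mul, map_zero] using
      RingQuot.mkAlgHom_rel K (PathRel.orth (K := K) i j hij)
  simp only [e, ← map_mul, h, map_zero]

theorem e_R_add_e_M : e K lam Vertex.R + e K lam Vertex.M = 1 := by
  have h : ∑ i : Vertex, PathAlg.idem K i = 1 := by
    simpa only [PathAlg.idem, map_sum, map_one] using
      RingQuot.mkAlgHom_rel K (PathRel.one (K := K) (V := Vertex))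
  rw [show (Finset.univ : Finset Vertex) = {Vertex.R, Vertex.M} from rfl,
    Finset.sum_pair (by decide)] at h
  simp only [e, ← map_add, h, map_one]

theorem quo_eq_zero {x : P K} (h : Rel K lam x 0) : quo K lam x = 0 := by
  rw [quo, RingQuot.mkAlgHom_rel K h, map_zero]

/-- The quiver algebra as a realization of its quiver with relations. -/
noncomputable def realization : Realization lam (A K lam) where
  r := e K lam Vertex.R
  m := e K lam Vertex.M
  a := quo K lam (pa K)
  b := b K lam
  c := c K lam
  d := d K lam
  r_add_m := e_R_add_e_M K lam
  r_mul_m := e_mul_e_of_ne K lam (by decide)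
  m_mul_a := e_mul_arrow K lam _
  a_mul_m := arrow_mul_e K lam _
  m_mul_b := e_mul_b K lam
  b_mul_m := arrow_mul_e K lam _
  r_mul_c := e_mul_c K lam
  c_mul_m := arrow_mul_e K lam _
  m_mul_d := e_mul_d K lam
  d_mul_r := arrow_mul_e K lam _
  u_mul_d := by simpa only [map_add, map_mul, map_pow] using! quo_eq_zero K lam Rel.rel_c
  c_mul_u := by simpa only [map_add, map_mul, map_pow] using! quo_eq_zero K lam Rel.rel_d
  a_mul_b_add_b_mul_a := by simpa only [map_add, map_mul] using! quo_eq_zero K lam Rel.rel_a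
  a_sq_add := by
    simpa only [map_add, map_mul, map_pow, map_smul] using! quo_eq_zero K lam Rel.rel_b

theorem adjoin_generators_realization :
    Algebra.adjoin K (realization K lam).generators = ⊤ := by
  rw [eq_top_iff]
  rintro x -
  obtain ⟨y, rfl⟩ := RingQuot.mkAlgHom_surjective K (Rel K lam) x
  obtain ⟨z, rfl⟩ := RingQuot.mkAlgHom_surjective K (PathRel K Vertex) y
  induction z using FreeAlgebra.induction with
  | grade0 r => simp
  | grade1 g =>
    apply Algebra.subset_adjoin
    rcases g with (_ | _) | (_ | _ | _ | _)
    exacts [.inl rfl, .inr (.inl rfl), .inr (.inr (.inl rfl)), .inr (.inr (.inr (.inl rfl))),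
      .inr (.inr (.inr (.inr (.inl rfl)))), .inr (.inr (.inr (.inr (.inr rfl))))]
  | mul x y hx hy => simpa using Subalgebra.mul_mem _ hx hy
  | add x y hx hy => simpa using Subalgebra.add_mem _ hx hy

theorem map_realization_lift {X : Type v} [Ring X] [Algebra K X] (S : Realization lam X) :
    (realization K lam).map (S.lift : A K lam →+* X) = S.toQuiverData := by
  ext
  · exact (S.lift_quo _).trans (S.liftPath_idem _)
  · exact (S.lift_quo _).trans (S.liftPath_idem _)
  · exact (S.lift_quo _).trans S.liftPath_pa
  · exact (S.lift_quo _).trans S.liftPath_pb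
  · exact (S.lift_quo _).trans S.liftPath_pc
  · exact (S.lift_quo _).trans S.liftPath_pd

/-- The variables `X 0`, `X 1`, `X 2` act as the central elements `t`, `v`, `w`. -/
noncomputable instance : Algebra (MvPolynomial (Fin 3) K) (A K lam) :=
  (realization K lam).algebraMvPolynomial (adjoin_generators_realization K lam)

instance : IsScalarTower K (MvPolynomial (Fin 3) K) (A K lam) :=
  .of_algebraMap_eq fun k => by
    rw [MvPolynomial.algebraMap_eq]
    exact (((Subalgebra.center K (A K lam)).val.comp
      ((realization K lam).toCenter (adjoin_generators_realization K lam))).commutes k).symm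

theorem algebraMap_X_zero :
    algebraMap (MvPolynomial (Fin 3) K) (A K lam) (.X 0) = (realization K lam).centT :=
  congrArg Subtype.val (MvPolynomial.aeval_X _ (0 : Fin 3))

theorem algebraMap_X_one :
    algebraMap (MvPolynomial (Fin 3) K) (A K lam) (.X 1) = (realization K lam).centV :=
  congrArg Subtype.val (MvPolynomial.aeval_X _ (1 : Fin 3))

theorem algebraMap_X_two :
    algebraMap (MvPolynomial (Fin 3) K) (A K lam) (.X 2) = (realization K lam).centW :=
  congrArg Subtype.val (MvPolynomial.aeval_X _ (2 : Fin 3))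

theorem adjoin_eq_top_of_isScalarTower {B X : Type*} [CommSemiring B] [Semiring X] {K : Type*}
    [CommSemiring K] [Algebra K B] [Algebra K X] [Algebra B X] [IsScalarTower K B X] {s : Set X}
    (hs : Algebra.adjoin K s = ⊤) : Algebra.adjoin B s = ⊤ := by
  have h : Algebra.adjoin K s ≤ (Algebra.adjoin B s).restrictScalars K :=
    Algebra.adjoin_le Algebra.subset_adjoin
  exact eq_top_iff.2 fun x _ => h (hs ▸ Algebra.mem_top)

/-- The quiver algebra as a central realization over `K[t, v, w]`. -/
noncomputable def centralRealization :
    CentralRealization (.X 2 - lam • .X 0 : MvPolynomial (Fin 3) K) (.X 0) (.X 1) (.X 2)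
      (A K lam) :=
  (realization K lam).toCentral (algebraMap_X_zero K lam) (algebraMap_X_one K lam)
    (algebraMap_X_two K lam)

theorem adjoin_generators_centralRealization :
    Algebra.adjoin (MvPolynomial (Fin 3) K) (centralRealization K lam).generators = ⊤ :=
  adjoin_eq_top_of_isScalarTower (adjoin_generators_realization K lam)

theorem lift_algebraMap {X : Type v} [Ring X] [Algebra K X] [Algebra (MvPolynomial (Fin 3) K) X]
    [IsScalarTower K (MvPolynomial (Fin 3) K) X]
    (S : CentralRealization (.X 2 - lam • .X 0 : MvPolynomial (Fin 3) K) (.X 0) (.X 1) (.X 2) X)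
    (p : MvPolynomial (Fin 3) K) :
    S.toRealization.lift (algebraMap (MvPolynomial (Fin 3) K) (A K lam) p) =
      algebraMap (MvPolynomial (Fin 3) K) X p := by
  have hS := map_realization_lift K lam S.toRealization
  suffices S.toRealization.lift.comp (IsScalarTower.toAlgHom K _ (A K lam)) =
      IsScalarTower.toAlgHom K (MvPolynomial (Fin 3) K) X from DFunLike.congr_fun this p
  refine MvPolynomial.algHom_ext fun i => ?_
  fin_cases i
  · exact (congrArg S.toRealization.lift (algebraMap_X_zero K lam)).trans <|
      ((realization K lam).map_centT _).trans <| (congrArg QuiverData.centT hS).trans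
        S.algebraMap_t.symm
  · exact (congrArg S.toRealization.lift (algebraMap_X_one K lam)).trans <|
      ((realization K lam).map_centV _).trans <| (congrArg QuiverData.centV hS).trans
        S.algebraMap_v.symm
  · exact (congrArg S.toRealization.lift (algebraMap_X_two K lam)).trans <|
      ((realization K lam).map_centW _).trans <| (congrArg QuiverData.centW hS).trans
        S.algebraMap_w.symm

end QuiverAlgebra

theorem projective_span_singleton_of_isIdempotentElem {X : Type*} [Semiring X] {f : X}
    (hf : IsIdempotentElem f) : Module.Projective Xᵐᵒᵖ (Submodule.span Xᵐᵒᵖ {f}) := by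
  let s : Submodule.span Xᵐᵒᵖ {f} →ₗ[Xᵐᵒᵖ] Xᵐᵒᵖ :=
    { toFun x := MulOpposite.op x
      map_add' _ _ := rfl
      map_smul' _ _ := rfl }
  refine .of_split s (LinearMap.toSpanSingleton _ _ ⟨f, Submodule.mem_span_singleton_self f⟩) ?_
  ext ⟨x, hx⟩
  obtain ⟨y, rfl⟩ := Submodule.mem_span_singleton.1 hx
  simp [s, hf.mul_self_mul]

section Resolution

open Function MvPolynomial
variable (K : Type u) [Field K] (lam : K)

theorem char_e_self (i : Vertex) : char K lam i (e K lam i) = 1 := by simp [char, e, quo]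

theorem char_arrow (i : Vertex) {j k : Vertex} (f : j ⟶ k) :
    char K lam i (quo K lam (PathAlg.arrow K f)) = 0 := by simp [char, quo]

theorem char_algebraMap (i : Vertex) (p : MvPolynomial (Fin 3) K) :
    char K lam i (algebraMap _ _ p) = constantCoeff p := by
  suffices (char K lam i).comp (IsScalarTower.toAlgHom K _ (A K lam)) = aeval 0 by
    rw [← Algebra.algebraMap_self_apply (constantCoeff p), ← aeval_zero p]
    exact DFunLike.congr_fun this p
  have ha : char K lam i (realization K lam).a = 0 := char_arrow K lam i _
  have hb : char K lam i (realization K lam).b = 0 := char_arrow K lam i _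
  have hc : char K lam i (realization K lam).c = 0 := char_arrow K lam i _
  refine algHom_ext fun j => ?_
  fin_cases j
  · simp [algebraMap_X_zero, QuiverData.centT, hb, hc]
  · simp [algebraMap_X_one, QuiverData.centV, ha, hb, hc]
  · simp [algebraMap_X_two, QuiverData.centW, hb, hc]

theorem isRegular_X_zero_two_one :
    IsRegular (MvPolynomial (Fin 3) K)
      [(X 0 : MvPolynomial (Fin 3) K), X 2, X 1] :=
  isRegular_map_X (l := [(0 : Fin 3), 2, 1]) (by decide)

theorem eq_zero_of_quat_mul_d
    {q : ℍ[MvPolynomial (Fin 3) K,X 2 - lam • X 0,X 0]}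
    (hq : (centralRealization K lam).quat q * d K lam = 0) : q = 0 := by
  let T := model (X 2 - lam • X 0 : MvPolynomial (Fin 3) K) (X 0) (X 1) (X 2)
  let φ : A K lam →ₐ[MvPolynomial (Fin 3) K] _ :=
    { T.toRealization.lift with commutes' := lift_algebraMap K lam T }
  exact (centralRealization K lam).eq_zero_of_quat_mul_d T φ
    (map_realization_lift K lam T.toRealization)
    (fun _ => model_eq_zero_of_quat_mul_d _ _ _ _) hq

theorem projective_Proj (i : Vertex) : Module.Projective (A K lam)ᵐᵒᵖ (Proj K lam i) :=
  projective_span_singleton_of_isIdempotentElem (e_mul_e K lam i)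

theorem mapD_injective : Injective (mapD K lam) := fun x y hxy => Subtype.ext <|
  CentralRealization.eq_of_d_mul_eq (fun _ => eq_zero_of_quat_mul_d K lam)
    (adjoin_generators_centralRealization K lam) (isRegular_X_zero_two_one K).toIsWeaklyRegular
    ((mem_Proj K lam).1 x.2) ((mem_Proj K lam).1 y.2) (congrArg Subtype.val hxy)

variable {K lam}

theorem exact_leftMul {i j : Vertex} {g : A K lam} (hg : e K lam j * g = g) {N : Type*}
    [AddCommMonoid N] [Module (A K lam)ᵐᵒᵖ N] {f : Proj K lam j →ₗ[(A K lam)ᵐᵒᵖ] N}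
    (hgi : g * e K lam i = g) (hfg : ∀ y, f (leftMul K lam i g hg y) = 0)
    (h : ∀ x : Proj K lam j, f x = 0 → ∃ y, g * y = x) : Exact (leftMul K lam i g hg) f := by
  refine fun x => ⟨fun hx => ?_, fun ⟨y, hy⟩ => hy ▸ hfg y⟩
  obtain ⟨y, hy⟩ := h x hx
  exact ⟨⟨e K lam i * y, (mem_Proj K lam).2 (by rw [← mul_assoc, e_mul_e])⟩,
    Subtype.ext (by rw [← hy]; exact mul_mul_of_eq hgi y)⟩

variable (K lam)

theorem exact_mapD_mapB : Exact (mapD K lam) (mapB K lam) :=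
  exact_leftMul (e_mul_d K lam) (realization K lam).d_mul_r
    (fun _ => Subtype.ext <| (mul_mul_of_eq (realization K lam).u_mul_d _).trans (zero_mul _))
    fun x hx => CentralRealization.exists_d_mul_eq (fun _ => eq_zero_of_quat_mul_d K lam)
      (adjoin_generators_centralRealization K lam) (isRegular_X_zero_two_one K)
      ((mem_Proj K lam).1 x.2) (congrArg Subtype.val hx)

theorem exact_mapB_mapC : Exact (mapB K lam) (mapC K lam) :=
  exact_leftMul (g := b K lam ^ 2 + d K lam * c K lam) (realization K lam).m_mul_u
    (realization K lam).u_mul_m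
    (fun _ => Subtype.ext <| (mul_mul_of_eq (realization K lam).c_mul_u _).trans (zero_mul _))
    fun x hx => CentralRealization.exists_u_mul_eq (fun _ => eq_zero_of_quat_mul_d K lam)
      (adjoin_generators_centralRealization K lam) (isRegular_X_zero_two_one K).toIsWeaklyRegular
      ((mem_Proj K lam).1 x.2) (congrArg Subtype.val hx)

theorem exact_mapC_aug : Exact (mapC K lam) (aug K lam Vertex.R) := by
  refine exact_leftMul (e_mul_c K lam) (realization K lam).c_mul_m (fun y => ?_) fun x hx => ?_
  · change char K lam Vertex.R (c K lam * y) = 0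
    rw [map_mul, c, pc, char_arrow, zero_mul]
  · refine CentralRealization.exists_c_mul_eq (adjoin_generators_centralRealization K lam)
      (char K lam Vertex.R : A K lam →+* K) (char_e_self K lam Vertex.R)
      (char_arrow K lam Vertex.R _) (fun p hp => ?_) ((mem_Proj K lam).1 x.2) hx
    have hrange : Set.range X ⊆ ({X 0, X 2, X 1} : Set (MvPolynomial (Fin 3) K)) :=
      Set.range_subset_iff.2 fun i => by fin_cases i <;> simp
    exact Ideal.span_mono hrange <|
      mem_idealOfVars_of_constantCoeff_eq_zero ((char_algebraMap K lam _ p).symm.trans hp)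

theorem aug_surjective (i : Vertex) : Surjective (aug K lam i) := fun k : K =>
  ⟨⟨e K lam i * algebraMap K (A K lam) k, by rw [mem_Proj, ← mul_assoc, e_mul_e]⟩, by
    change char K lam i (e K lam i * algebraMap K (A K lam) k) = k
    rw [map_mul, char_e_self, one_mul, AlgHom.commutes]
    rfl⟩

end Resolution
end MorrisonPinkham

open MorrisonPinkham in
theorem theorem3 (K : Type*) [Field K] (lam : K) :
    Module.Projective (A K lam)ᵐᵒᵖ (Proj K lam Vertex.R) ∧
    Module.Projective (A K lam)ᵐᵒᵖ (Proj K lam Vertex.M) ∧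
    Function.Injective (mapD K lam) ∧
    Function.Exact (mapD K lam) (mapB K lam) ∧
    Function.Exact (mapB K lam) (mapC K lam) ∧
    Function.Exact (mapC K lam) (aug K lam Vertex.R) ∧
    Function.Surjective (aug K lam Vertex.R) :=
  ⟨projective_Proj K lam _, projective_Proj K lam _, mapD_injective K lam, exact_mapD_mapB K lam,
    exact_mapB_mapC K lam, exact_mapC_aug K lam, aug_surjective K lam _⟩
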